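/- **Setting.** A program $P$ consists of a signature and a set of rewrite rules. The signature declares (possibly polymorphic) algebraic data types with their constructors, and first-order operations $f$ with (possibly polymorphic) types $\tau_1\to\dots\to\tau_n\to\tau'$. A rule has the form $f\,t_1\dots t_n = r$, is well-typed and left-linear, its $t_i$ are built from constructors and variables only, and every variable of $r$ occurs in some $t_i$. An *expression* over the signature is a well-typed term built from constructors and operations, without variables; a *value* is an expression without operations. The reduction relation $\to$ of $P$ is given by the rule $$\text{(Fun)}\qquad C[f\,\sigma(t_1)\dots\sigma(t_n)]\ \to\ C[\sigma(r)]$$ for every rule $f\,t_1\dots t_n=r$ of $P$, every context $C[\cdot]$ and every substitution $\sigma$ of values for the variables; $f\,\sigma(t_1)\dots\sigma(t_n)$ is then a *redex* rooted by $f$ with *reduct* $\sigma(r)$. The relation $\to_\bot$ is obtained from $\to$ by adding a symbol $\bot$ (undefined or unevaluated), by allowing $\sigma$ to map variables to partial values (terms built from constructors and $\bot$), and by adding the rule $$\text{(Bot)}\qquad C[e]\ \to_\bot\ C[\bot]\quad (e\neq\bot).$$ As usual, $\to^*$ and $\to_\bot^*$ are the reflexive and transitive closures. An operation $f$ of type $\tau_1\to\dots\to\tau_n\to\tau'$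 is *totally defined* iff for all values $v_i$ of type $\tau_i$ (for every instance of the type of $f$) there is a value $v$ of type $\tau'$ with $f\,v_1\dots v_n\to^* v$; it is *deterministically defined* iff every redex rooted by $f$ has only one reduct. Let $f_1,f_2$ be operations of $P$ of the same type $\tau_1\to\dots\to\tau_n\to\tau'$. They are *ground equivalent* iff, for all values $v_i$ of type $\tau_i$ (for every instance of this type) and every value $v$, $f_1\,v_1\dots v_n\to^* v$ iff $f_2\,v_1\dots v_n\to^* v$. They are *equivalent* (contextually) with respect to a reduction relation $\Rightarrow$ iff, for every expression $E_1$ over the signature of $P$ and every value $v$, $E_1\Rightarrow^* v$ iff $E_2\Rightarrow^* v$, where $E_2$ is obtained from $E_1$ by replacing each occurrence of $f_1$ with $f_2$. **Theorem.** Let $P$ be a program in which every operation is both totally and deterministically defined, and let $f_1,f_2$ be operations of $P$ of the same type. If $f_1$ and $f_2$ are ground equivalent, then $f_1$ and $f_2$ are equivalent with respect to $\to$, and they are also equivalent with respect to the non-strict relation $\to_\bot$. -/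

import Mathlib

namespace FLP

universe u v w

/-- First-order types over type constructors `T` with arities `ar` and type variables in `α`. -/
inductive Ty {T : Type u} (ar : T → ℕ) (α : Type) : Type u where
  | var (a : α) : Ty ar α
  | con (t : T) (args : Fin (ar t) → Ty ar α) : Ty ar α

/-- Instantiation of type variables. -/
def Ty.subst {T : Type u} {ar : T → ℕ} {α β : Type} (θ : α → Ty ar β) : Ty ar α → Ty ar β
  | .var a => θ a
  | .con t args => .con t (fun i => (args i).subst θ)

/-- The (possibly polymorphic) type `τ₁ → ⋯ → τₙ → τ'` of an operation. -/
structure OpTy {T : Type u} (ar : T → ℕ) : Type u where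
  arity : ℕ
  arg : Fin arity → Ty ar ℕ
  res : Ty ar ℕ

/-- The signature of a program: data types with their constructors, and typed operations.
A constructor `c` is declared as in `data T a₁ … aₖ = … | c τ₁ … τₙ | …`, where
`T = conTy c`, `n = conArity c` and `τᵢ = conArg c i` is a type in the variables `a₁, …, aₖ`. -/
structure Signature where
  TyCon : Type u
  tyArity : TyCon → ℕ
  Con : Type v
  conTy : Con → TyCon
  conArity : Con → ℕ
  conArg : (c : Con) → Fin (conArity c) → Ty tyArity (Fin (tyArity (conTy c)))
  Op : Type w
  opTy : Op → OpTy tyArity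

/-- Types of a signature, with type variables named by natural numbers. -/
abbrev Signature.Ty (S : Signature.{u, v, w}) : Type u := FLP.Ty S.tyArity ℕ

/-- Expressions: variables, the symbol `⊥`, and saturated applications of constructors and
operations. -/
inductive Expr (S : Signature.{u, v, w}) : Type (max v w) where
  | var (x : ℕ) : Expr S
  | bot : Expr S
  | con (c : S.Con) (args : Fin (S.conArity c) → Expr S) : Expr S
  | op (f : S.Op) (args : Fin (S.opTy f).arity → Expr S) : Expr S

variable {S : Signature.{u, v, w}}

/-- A value is an expression without operations, variables and `⊥`. -/
def Expr.IsValue : Expr S → Prop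
  | .var _ => False
  | .bot => False
  | .con _ args => ∀ i, (args i).IsValue
  | .op _ _ => False

/-- A partial value is an expression built from constructors and `⊥`. -/
def Expr.IsPartialValue : Expr S → Prop
  | .var _ => False
  | .bot => True
  | .con _ args => ∀ i, (args i).IsPartialValue
  | .op _ _ => False

/-- A pattern is an expression built from constructors and variables. -/
def Expr.IsPattern : Expr S → Prop
  | .var _ => True
  | .bot => False
  | .con _ args => ∀ i, (args i).IsPattern
  | .op _ _ => False

/-- The number of occurrences of the variable `x`. -/
def Expr.occ (x : ℕ) : Expr S → ℕ
  | .var y => if y = x then 1 else 0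
  | .bot => 0
  | .con _ args => ∑ i, (args i).occ x
  | .op _ args => ∑ i, (args i).occ x

/-- Application of a substitution. -/
def Expr.subst (σ : ℕ → Expr S) : Expr S → Expr S
  | .var x => σ x
  | .bot => .bot
  | .con c args => .con c (fun i => (args i).subst σ)
  | .op f args => .op f (fun i => (args i).subst σ)

/-- Typing relative to a partial assignment of types to variables. Constructors and operations
may be used at every instance of their declared types. The symbol `⊥` does not belong to the
signature and has no typing rule, so every typable expression is free of `⊥`. -/
inductive HasType (Γ : ℕ → Option S.Ty) : Expr S → S.Ty → Prop where
  | var (x : ℕ) (τ : S.Ty) (h : Γ x = some τ) : HasType Γ (.var x) τ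
  | con (c : S.Con) (θ : Fin (S.tyArity (S.conTy c)) → S.Ty)
      (args : Fin (S.conArity c) → Expr S)
      (h : ∀ i, HasType Γ (args i) ((S.conArg c i).subst θ)) :
      HasType Γ (.con c args) (.con (S.conTy c) θ)
  | op (f : S.Op) (θ : ℕ → S.Ty) (args : Fin (S.opTy f).arity → Expr S)
      (h : ∀ i, HasType Γ (args i) (((S.opTy f).arg i).subst θ)) :
      HasType Γ (.op f args) ((S.opTy f).res.subst θ)

/-- `e` is a ground expression over the signature (no variables, no `⊥`) of type `τ`. -/
def Expr.OfType (e : Expr S) (τ : S.Ty) : Prop := HasType (fun _ => none) e τ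

/-- A rewrite rule `f t₁ … tₙ = r`. -/
structure Rule (S : Signature.{u, v, w}) where
  op : S.Op
  lhs : Fin (S.opTy op).arity → Expr S
  rhs : Expr S

/-- The rule is a well-typed, left-linear, constructor-based rule without extra variables. -/
structure Rule.WellFormed (r : Rule S) : Prop where
  pattern : ∀ i, (r.lhs i).IsPattern
  linear : ∀ x, ∑ i, (r.lhs i).occ x ≤ 1
  noExtra : ∀ x, r.rhs.occ x ≠ 0 → ∃ i, (r.lhs i).occ x ≠ 0
  typed : ∃ Γ : ℕ → Option S.Ty,
    (∀ i, HasType Γ (r.lhs i) ((S.opTy r.op).arg i)) ∧ HasType Γ r.rhs (S.opTy r.op).res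

/-- A program over a signature. -/
structure Program (S : Signature.{u, v, w}) where
  rules : Set (Rule S)
  wf : ∀ r ∈ rules, r.WellFormed

/-- Closure of a relation under contexts `C[·]`. -/
inductive InContext (R : Expr S → Expr S → Prop) : Expr S → Expr S → Prop where
  | here {e e' : Expr S} (h : R e e') : InContext R e e'
  | con (c : S.Con) (args : Fin (S.conArity c) → Expr S) (i : Fin (S.conArity c)) {e' : Expr S}
      (h : InContext R (args i) e') : InContext R (.con c args) (.con c (Function.update args i e'))
  | op (f : S.Op) (args : Fin (S.opTy f).arity → Expr S) (i : Fin (S.opTy f).arity) {e' : Expr S}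
      (h : InContext R (args i) e') : InContext R (.op f args) (.op f (Function.update args i e'))

/-- `Contracts P e e'`: `e = f σ(t₁) … σ(tₙ)` is a redex with reduct `e' = σ(r)`, for a rule
`f t₁ … tₙ = r` of `P` and a partial constructor substitution `σ`. -/
inductive Contracts (P : Program S) : Expr S → Expr S → Prop where
  | mk (r : Rule S) (hr : r ∈ P.rules) (σ : ℕ → Expr S) (hσ : ∀ x, (σ x).IsPartialValue) :
      Contracts P (.op r.op (fun i => (r.lhs i).subst σ)) (r.rhs.subst σ)

/-- The reduction relation with rule (Fun) only. Started from an expression without `⊥`, it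
never produces `⊥`, and the substitutions then bind the variables of the rule to values. -/
def FunStep (P : Program S) : Expr S → Expr S → Prop := InContext (Contracts P)

/-- The reduction relation with the rules (Fun) and (Bot). -/
def FunBotStep (P : Program S) : Expr S → Expr S → Prop :=
  InContext (fun e e' => Contracts P e e' ∨ (e ≠ .bot ∧ e' = .bot))

/-- Every application of `f` to values of its argument types evaluates to a value of its result
type (for every instance of the type of `f`). -/
def TotallyDefined (P : Program S) (f : S.Op) : Prop :=
  ∀ (θ : ℕ → S.Ty) (args : Fin (S.opTy f).arity → Expr S),
    (∀ i, (args i).IsValue ∧ (args i).OfType (((S.opTy f).arg i).subst θ)) →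
    ∃ t : Expr S, t.IsValue ∧ t.OfType ((S.opTy f).res.subst θ) ∧
      Relation.ReflTransGen (FunStep P) (.op f args) t

/-- Every redex rooted by `f` has only one reduct. -/
def DeterministicallyDefined (P : Program S) (f : S.Op) : Prop :=
  ∀ (args : Fin (S.opTy f).arity → Expr S) (τ : S.Ty) (e e' : Expr S),
    (Expr.op f args).OfType τ →
    Contracts P (.op f args) e → Contracts P (.op f args) e' → e = e'

/-- Application of an operation `f` of type `τ` to arguments. -/
def Expr.app {τ : OpTy S.tyArity} (f : S.Op) (h : S.opTy f = τ) (args : Fin τ.arity → Expr S) :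
    Expr S :=
  .op f (fun i => args (i.cast (congrArg OpTy.arity h)))

open Classical in
/-- Replacement of each occurrence of `f₁` by `f₂`, two operations of the same type `τ`. -/
noncomputable def Expr.replace {τ : OpTy S.tyArity} (f₁ f₂ : S.Op)
    (h₁ : S.opTy f₁ = τ) (h₂ : S.opTy f₂ = τ) : Expr S → Expr S
  | .var x => .var x
  | .bot => .bot
  | .con c args => .con c (fun i => (args i).replace f₁ f₂ h₁ h₂)
  | .op f args =>
      if hf : f = f₁ then
        .app f₂ h₂ (fun i => (args (i.cast (by rw [hf, h₁]))).replace f₁ f₂ h₁ h₂)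
      else .op f (fun i => (args i).replace f₁ f₂ h₁ h₂)

/-- `f₁` and `f₂`, of type `τ`, yield the same values on all values as arguments. -/
def GroundEquivalent (P : Program S) {τ : OpTy S.tyArity} (f₁ f₂ : S.Op)
    (h₁ : S.opTy f₁ = τ) (h₂ : S.opTy f₂ = τ) : Prop :=
  ∀ (θ : ℕ → S.Ty) (args : Fin τ.arity → Expr S),
    (∀ i, (args i).IsValue ∧ (args i).OfType ((τ.arg i).subst θ)) →
    ∀ t : Expr S, t.IsValue →
      (Relation.ReflTransGen (FunStep P) (.app f₁ h₁ args) t ↔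
        Relation.ReflTransGen (FunStep P) (.app f₂ h₂ args) t)

/-- (Contextual) equivalence of `f₁` and `f₂`, of type `τ`, with respect to a reduction
relation: every expression `E` has the same values as the expression obtained from `E` by
replacing each occurrence of `f₁` with `f₂`. -/
def Equivalent (step : Expr S → Expr S → Prop) {τ : OpTy S.tyArity} (f₁ f₂ : S.Op)
    (h₁ : S.opTy f₁ = τ) (h₂ : S.opTy f₂ = τ) : Prop :=
  ∀ (E : Expr S) (ρ : S.Ty), E.OfType ρ → ∀ t : Expr S, t.IsValue →
    (Relation.ReflTransGen step E t ↔
      Relation.ReflTransGen step (E.replace f₁ f₂ h₁ h₂) t)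

end FLP

namespace FLP

open Relation

universe u v w

variable {S : Signature.{u, v, w}}

/-! ### Typing -/

/-! Totality lets innermost evaluation bring every typable ground expression to a value
(`exists_value`). Run on `E` and on its replacement in parallel, it reaches applications of `f₁` and
`f₂` to the same values, where ground equivalence applies; so both expressions share a value
(`exists_common_value`). Arguments of a redex are irreducible, hence redexes never nest; with
determinism this gives a diamond property, so values are unique (`value_unique`) and the strict
claim follows.

The non-strict claim reduces to the strict one: both relations reach the same values. If `p`
approximates `e`, a non-strict step from `p` is matched by strict steps from `e` to something that
the new term still approximates (`Approx.exists_of_funBotStep`); a value approximates only itself.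
-/

theorem Ty.subst_subst {T : Type u} {ar : T → ℕ} {α β γ : Type} (θ : α → Ty ar β)
    (η : β → Ty ar γ) (t : Ty ar α) :
    (t.subst θ).subst η = t.subst (fun a => (θ a).subst η) := by
  induction t with
  | var a => rfl
  | con t args ih => simp only [Ty.subst, ih]

theorem HasType.con_inv {Γ : ℕ → Option S.Ty} {c : S.Con} {args : Fin (S.conArity c) → Expr S}
    {τ : S.Ty} (h : HasType Γ (.con c args) τ) :
    ∃ θ : Fin (S.tyArity (S.conTy c)) → S.Ty, τ = .con (S.conTy c) θ ∧
      ∀ i, HasType Γ (args i) ((S.conArg c i).subst θ) := by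
  cases h with
  | con c θ args h => exact ⟨θ, rfl, h⟩

theorem HasType.op_inv {Γ : ℕ → Option S.Ty} {f : S.Op}
    {args : Fin (S.opTy f).arity → Expr S} {τ : S.Ty} (h : HasType Γ (.op f args) τ) :
    ∃ θ : ℕ → S.Ty, τ = (S.opTy f).res.subst θ ∧
      ∀ i, HasType Γ (args i) (((S.opTy f).arg i).subst θ) := by
  cases h with
  | op f θ args h => exact ⟨θ, rfl, h⟩

theorem HasType.var_inv {Γ : ℕ → Option S.Ty} {x : ℕ} {τ : S.Ty}
    (h : HasType Γ (.var x) τ) : Γ x = some τ := by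
  cases h with
  | var x τ h => exact h

/-- The hypothesis covers only variables that occur in `e`, since matching a left-hand side gives no
type to the other bindings. -/
theorem HasType.subst {Γ Δ : ℕ → Option S.Ty} {e : Expr S} {τ : S.Ty} (h : HasType Γ e τ)
    (θ : ℕ → S.Ty) (σ : ℕ → Expr S)
    (hσ : ∀ x A, e.occ x ≠ 0 → Γ x = some A → HasType Δ (σ x) (A.subst θ)) :
    HasType Δ (e.subst σ) (τ.subst θ) := by
  induction h with
  | var x τ h => exact hσ x τ (by simp [Expr.occ]) h
  | con c η args h ih =>
    refine HasType.con c (fun j => (η j).subst θ) _ fun i => ?_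
    rw [← Ty.subst_subst]
    refine ih i fun x A hx hA => hσ x A ?_ hA
    simp only [Expr.occ, ne_eq, Finset.sum_eq_zero_iff, not_forall]
    exact ⟨i, Finset.mem_univ i, hx⟩
  | op f η args h ih =>
    rw [Ty.subst_subst]
    refine HasType.op f (fun j => (η j).subst θ) _ fun i => ?_
    rw [← Ty.subst_subst]
    refine ih i fun x A hx hA => hσ x A ?_ hA
    simp only [Expr.occ, ne_eq, Finset.sum_eq_zero_iff, not_forall]
    exact ⟨i, Finset.mem_univ i, hx⟩

/-- Matching a pattern against an expression types the bindings of its variables. -/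
theorem HasType.of_subst_pattern {Γ Δ : ℕ → Option S.Ty} {t : Expr S} {τ : S.Ty}
    (h : HasType Γ t τ) (ht : t.IsPattern) (θ : ℕ → S.Ty) (σ : ℕ → Expr S)
    (hσ : HasType Δ (t.subst σ) (τ.subst θ)) {x : ℕ} (hx : t.occ x ≠ 0) {A : S.Ty}
    (hA : Γ x = some A) : HasType Δ (σ x) (A.subst θ) := by
  induction h with
  | var y τ h =>
    have hyx : y = x := by
      by_contra hne
      simp [Expr.occ, hne] at hx
    subst hyx
    cases h.symm.trans hA
    exact hσ
  | con c η args h ih =>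
    simp only [Expr.occ, ne_eq, Finset.sum_eq_zero_iff, not_forall] at hx
    obtain ⟨i, -, hi⟩ := hx
    obtain ⟨η', hη, hargs⟩ := HasType.con_inv hσ
    -- The argument types of a constructor involve only the parameters of its data type, so the type
    -- of the instance determines `η'`.
    have hη' : (fun j => (η j).subst θ) = η' := by
      simpa [Ty.subst] using hη
    refine ih i (ht i) ?_ hi
    rw [Ty.subst_subst, hη']
    exact hargs i
  | op f η args h ih => exact ht.elim

theorem Contracts.ofType {P : Program S} {e e' : Expr S} (h : Contracts P e e') {τ : S.Ty}
    (he : e.OfType τ) : e'.OfType τ := by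
  cases h with
  | mk r hr σ hσ =>
    obtain ⟨θ, rfl, hargs⟩ := HasType.op_inv he
    obtain ⟨Γ, hl, hres⟩ := (P.wf r hr).typed
    refine hres.subst θ σ fun x A hx hA => ?_
    obtain ⟨i, hi⟩ := (P.wf r hr).noExtra x hx
    exact (hl i).of_subst_pattern ((P.wf r hr).pattern i) θ σ (hargs i) hi hA

/-- Subject reduction. -/
theorem FunStep.ofType {P : Program S} {e e' : Expr S} (h : FunStep P e e') {τ : S.Ty}
    (he : e.OfType τ) : e'.OfType τ := by
  induction h generalizing τ with
  | here h => exact h.ofType he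
  | con c args i h ih =>
    obtain ⟨θ, rfl, hargs⟩ := HasType.con_inv he
    refine HasType.con c θ _ fun j => ?_
    by_cases hj : j = i
    · subst hj
      rw [Function.update_self]
      exact ih (hargs j)
    · simpa [hj] using hargs j
  | op f args i h ih =>
    obtain ⟨θ, rfl, hargs⟩ := HasType.op_inv he
    refine HasType.op f θ _ fun j => ?_
    by_cases hj : j = i
    · subst hj
      rw [Function.update_self]
      exact ih (hargs j)
    · simpa [hj] using hargs j

theorem ofType_of_reflTransGen_funStep {P : Program S} {e e' : Expr S}
    (h : ReflTransGen (FunStep P) e e') {τ : S.Ty} (he : e.OfType τ) : e'.OfType τ := by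
  induction h with
  | refl => exact he
  | tail _ h ih => exact h.ofType ih

/-! ### Confluence -/

theorem Expr.IsValue.isPartialValue {e : Expr S} (h : e.IsValue) : e.IsPartialValue := by
  induction e with
  | var => exact h
  | bot => trivial
  | con c args ih => exact fun i => ih i (h i)
  | op => exact h

theorem Expr.IsPattern.subst_isPartialValue {t : Expr S} (ht : t.IsPattern) {σ : ℕ → Expr S}
    (hσ : ∀ x, (σ x).IsPartialValue) : (t.subst σ).IsPartialValue := by
  induction t with
  | var x => exact hσ x
  | bot => exact ht.elim
  | con c args ih => exact fun i => ih i (ht i)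
  | op => exact ht.elim

theorem Contracts.isPartialValue_arg {P : Program S} {f : S.Op}
    {args : Fin (S.opTy f).arity → Expr S} {e : Expr S} (h : Contracts P (.op f args) e)
    (i : Fin (S.opTy f).arity) : (args i).IsPartialValue := by
  cases h with
  | mk r hr σ hσ => exact ((P.wf r hr).pattern i).subst_isPartialValue hσ

/-- Every redex is rooted by an operation, and a partial value contains none. -/
theorem Expr.IsPartialValue.not_funStep {P : Program S} {e e' : Expr S}
    (he : e.IsPartialValue) : ¬ FunStep P e e' := by
  intro h
  induction h with
  | here h => cases h with
    | mk => exact he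
  | con c args i h ih => exact ih (he i)
  | op => exact he

theorem Expr.IsValue.eq_of_reflTransGen {P : Program S} {e e' : Expr S}
    (he : e.IsValue) (h : ReflTransGen (FunStep P) e e') : e = e' := by
  cases h.cases_head with
  | inl h => exact h
  | inr h =>
    obtain ⟨_, h, -⟩ := h
    exact (he.isPartialValue.not_funStep h).elim

/-- Two redexes are equal, where determinism applies, or lie at disjoint positions, where the steps
commute. Nesting is excluded because the arguments of a redex are partial values. -/
theorem FunStep.diamond {P : Program S} (det : ∀ f : S.Op, DeterministicallyDefined P f)
    {e a b : Expr S} {τ : S.Ty} (he : e.OfType τ) (ha : FunStep P e a) (hb : FunStep P e b) :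
    a = b ∨ ∃ d, FunStep P a d ∧ FunStep P b d := by
  induction ha generalizing b τ with
  | here h =>
    cases h with
    | mk r hr σ hσ =>
      cases hb with
      | here h' => exact .inl (det r.op _ τ _ _ he (.mk r hr σ hσ) h')
      | op _ _ i h' =>
        exact (((P.wf r hr).pattern i).subst_isPartialValue hσ).not_funStep h' |>.elim
  | con c args i h ih =>
    rename_i a'
    obtain ⟨θ, rfl, hargs⟩ := HasType.con_inv he
    cases hb with
    | here h' => cases h'
    | con _ _ j h' =>
      rename_i b'
      by_cases hij : i = j
      · subst hij
        rcases ih (hargs i) h' with rfl | ⟨d, h1, h2⟩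
        · exact .inl rfl
        · refine .inr ⟨.con c (Function.update args i d), ?_, ?_⟩
          · simpa [FunStep] using InContext.con c (Function.update args i a') i (by rwa [Function.update_self])
          · simpa [FunStep] using InContext.con c (Function.update args i b') i (by rwa [Function.update_self])
      · refine .inr ⟨.con c (Function.update (Function.update args i a') j b'), ?_, ?_⟩
        · exact InContext.con c _ j (by simpa [Ne.symm hij] using h')
        · rw [Function.update_comm hij]
          exact InContext.con c _ i (by simpa [hij] using h)
  | op f args i h ih =>
    rename_i a'
    obtain ⟨θ, rfl, hargs⟩ := HasType.op_inv he
    cases hb with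
    | here h' => exact ((h'.isPartialValue_arg i).not_funStep h).elim
    | op _ _ j h' =>
      rename_i b'
      by_cases hij : i = j
      · subst hij
        rcases ih (hargs i) h' with rfl | ⟨d, h1, h2⟩
        · exact .inl rfl
        · refine .inr ⟨.op f (Function.update args i d), ?_, ?_⟩
          · simpa [FunStep] using InContext.op f (Function.update args i a') i (by rwa [Function.update_self])
          · simpa [FunStep] using InContext.op f (Function.update args i b') i (by rwa [Function.update_self])
      · refine .inr ⟨.op f (Function.update (Function.update args i a') j b'), ?_, ?_⟩
        · exact InContext.op f _ j (by simpa [Ne.symm hij] using h')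
        · rw [Function.update_comm hij]
          exact InContext.op f _ i (by simpa [hij] using h)

/-- A typable expression has at most one value. -/
theorem value_unique {P : Program S} (det : ∀ f : S.Op, DeterministicallyDefined P f)
    {e s t : Expr S} {τ : S.Ty} (he : e.OfType τ) (hs : s.IsValue) (ht : t.IsValue)
    (h₁ : ReflTransGen (FunStep P) e s) (h₂ : ReflTransGen (FunStep P) e t) : s = t := by
  -- Determinism is assumed only for typable redexes, so the type is carried along in the relation
  -- to which `church_rosser` is applied.
  let R : Expr S → Expr S → Prop := fun a b => a.OfType τ ∧ FunStep P a b
  have lift : ∀ {a}, ReflTransGen (FunStep P) e a → ReflTransGen R e a := by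
    intro a h
    induction h with
    | refl => exact .refl
    | tail h₀ h ih => exact ih.tail ⟨ofType_of_reflTransGen_funStep h₀ he, h⟩
  have lower : ∀ {a b}, ReflTransGen R a b → ReflTransGen (FunStep P) a b :=
    fun h => ReflTransGen.mono (r := R) (fun _ _ h => h.2) _ _ h
  obtain ⟨d, hd₁, hd₂⟩ := church_rosser (r := R) (fun a b c hb hc => by
    rcases FunStep.diamond det hb.1 hb.2 hc.2 with rfl | ⟨d, h₁, h₂⟩
    · exact ⟨b, .refl, .refl⟩
    · exact ⟨d, .single ⟨hb.2.ofType hb.1, h₁⟩, .single ⟨hc.2.ofType hc.1, h₂⟩⟩)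
    (lift h₁) (lift h₂)
  exact (hs.eq_of_reflTransGen (lower hd₁)).trans (ht.eq_of_reflTransGen (lower hd₂)).symm

/-! ### Evaluation -/

theorem reflTransGen_apply_of_forall {α : Type*} {R : α → α → Prop} {n : ℕ}
    (g : (Fin n → α) → α)
    (hg : ∀ (a : Fin n → α) i e, R (a i) e → R (g a) (g (Function.update a i e)))
    {a b : Fin n → α} (h : ∀ i, ReflTransGen R (a i) (b i)) :
    ReflTransGen R (g a) (g b) := by
  have single : ∀ (c : Fin n → α) i e, ReflTransGen R (c i) e →
      ReflTransGen R (g c) (g (Function.update c i e)) := by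
    intro c i e h
    induction h with
    | refl => simpa using ReflTransGen.refl
    | @tail x y _ h ih =>
      refine ih.tail ?_
      simpa using hg (Function.update c i x) i y (by simpa using h)
  -- Components are reduced one at a time; `s` is the set of positions already reduced.
  have key : ∀ s : Finset (Fin n), ReflTransGen R (g a) (g (s.piecewise b a)) := by
    intro s
    induction s using Finset.induction_on with
    | empty => simpa using ReflTransGen.refl
    | insert i s hi ih =>
      rw [Finset.piecewise_insert]
      exact ih.trans (single _ i _ (by simpa [hi] using h i))
  simpa using key Finset.univ

theorem reflTransGen_con {P : Program S} (c : S.Con) {a b : Fin (S.conArity c) → Expr S}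
    (h : ∀ i, ReflTransGen (FunStep P) (a i) (b i)) :
    ReflTransGen (FunStep P) (.con c a) (.con c b) :=
  reflTransGen_apply_of_forall (Expr.con c) (fun a i _ h => InContext.con c a i h) h

theorem reflTransGen_op {P : Program S} (f : S.Op) {a b : Fin (S.opTy f).arity → Expr S}
    (h : ∀ i, ReflTransGen (FunStep P) (a i) (b i)) :
    ReflTransGen (FunStep P) (.op f a) (.op f b) :=
  reflTransGen_apply_of_forall (Expr.op f) (fun a i _ h => InContext.op f a i h) h

/-- Structural induction suffices: once the arguments are values, totality supplies the rest of the
evaluation. Subject reduction keeps those values in the required types. -/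
theorem exists_value {P : Program S} (total : ∀ f : S.Op, TotallyDefined P f)
    {e : Expr S} {τ : S.Ty} (he : e.OfType τ) :
    ∃ t : Expr S, t.IsValue ∧ ReflTransGen (FunStep P) e t := by
  unfold Expr.OfType at he
  induction he with
  | var x τ h => cases h
  | con c θ args h ih =>
    choose t ht hr using ih
    exact ⟨.con c t, ht, reflTransGen_con c hr⟩
  | op f θ args h ih =>
    choose t ht hr using ih
    obtain ⟨v, hv, -, hev⟩ := total f θ t fun i =>
      ⟨ht i, ofType_of_reflTransGen_funStep (hr i) (h i)⟩
    exact ⟨v, hv, (reflTransGen_op f hr).trans hev⟩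

/-! ### Replacement -/

section Replace

variable {τ : OpTy S.tyArity} {f₁ f₂ : S.Op} {h₁ : S.opTy f₁ = τ} {h₂ : S.opTy f₂ = τ}

theorem Expr.replace_op_self (args : Fin (S.opTy f₁).arity → Expr S) :
    (Expr.op f₁ args).replace f₁ f₂ h₁ h₂ =
      .app f₂ h₂ (fun i =>
        (args (i.cast (congrArg OpTy.arity h₁.symm))).replace f₁ f₂ h₁ h₂) := by
  simp [Expr.replace]

theorem Expr.replace_op_of_ne {f : S.Op} (hf : f ≠ f₁)
    (args : Fin (S.opTy f).arity → Expr S) :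
    (Expr.op f args).replace f₁ f₂ h₁ h₂ =
      .op f (fun i => (args i).replace f₁ f₂ h₁ h₂) := by
  simp [Expr.replace, hf]

theorem HasType.app {Γ : ℕ → Option S.Ty} (f : S.Op) (hf : S.opTy f = τ) (θ : ℕ → S.Ty)
    {args : Fin τ.arity → Expr S} (h : ∀ i, HasType Γ (args i) ((τ.arg i).subst θ)) :
    HasType Γ (.app f hf args) (τ.res.subst θ) := by
  subst hf
  exact HasType.op f θ _ h

theorem HasType.replace {Γ : ℕ → Option S.Ty} {e : Expr S} {ρ : S.Ty} (h : HasType Γ e ρ) :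
    HasType Γ (e.replace f₁ f₂ h₁ h₂) ρ := by
  induction h with
  | var x ρ h => exact .var x ρ h
  | con c θ args h ih => exact .con c θ _ ih
  | op f θ args h ih =>
    by_cases hf : f = f₁
    · subst hf
      rw [Expr.replace_op_self]
      subst h₁
      exact HasType.app f₂ h₂ θ ih
    · rw [Expr.replace_op_of_ne hf]
      exact .op f θ _ ih

theorem reflTransGen_app {P : Program S} (f : S.Op) (hf : S.opTy f = τ)
    {a b : Fin τ.arity → Expr S} (h : ∀ i, ReflTransGen (FunStep P) (a i) (b i)) :
    ReflTransGen (FunStep P) (.app f hf a) (.app f hf b) :=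
  reflTransGen_op f fun _ => h _

/-- An expression and its replacement have a common value. -/
theorem exists_common_value {P : Program S} (total : ∀ f : S.Op, TotallyDefined P f)
    (ground : GroundEquivalent P f₁ f₂ h₁ h₂) {e : Expr S} {ρ : S.Ty} (he : e.OfType ρ) :
    ∃ t : Expr S, t.IsValue ∧ ReflTransGen (FunStep P) e t ∧
      ReflTransGen (FunStep P) (e.replace f₁ f₂ h₁ h₂) t := by
  unfold Expr.OfType at he
  induction he with
  | var x τ h => cases h
  | con c θ args h ih =>
    choose t ht hr hr' using ih
    exact ⟨.con c t, ht, reflTransGen_con c hr, reflTransGen_con c hr'⟩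
  | op f θ args h ih =>
    choose t ht hr hr' using ih
    have htyped := fun i => ofType_of_reflTransGen_funStep (hr i) (h i)
    obtain ⟨v, hv, -, hev⟩ := total f θ t fun i => ⟨ht i, htyped i⟩
    refine ⟨v, hv, (reflTransGen_op f hr).trans hev, ?_⟩
    by_cases hf : f = f₁
    · subst hf
      rw [Expr.replace_op_self]
      subst h₁
      exact (reflTransGen_app f₂ h₂ hr').trans
        ((ground θ t (fun i => ⟨ht i, htyped i⟩) v hv).1 hev)
    · rw [Expr.replace_op_of_ne hf]
      exact (reflTransGen_op f hr').trans hev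

theorem GroundEquivalent.equivalent_funStep {P : Program S}
    (ground : GroundEquivalent P f₁ f₂ h₁ h₂) (total : ∀ f : S.Op, TotallyDefined P f)
    (det : ∀ f : S.Op, DeterministicallyDefined P f) :
    Equivalent (FunStep P) f₁ f₂ h₁ h₂ := by
  intro e ρ he t ht
  obtain ⟨v, hv, hev, hev'⟩ := exists_common_value total ground he
  constructor
  · intro h
    rwa [value_unique det he ht hv h hev]
  · intro h
    rwa [value_unique det (HasType.replace he) ht hv h hev']

end Replace

/-! ### Approximation -/

/-- `Approx e e'`: `e` is obtained from `e'` by replacing some subexpressions with `⊥`. -/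
inductive Approx : Expr S → Expr S → Prop where
  | bot (e : Expr S) : Approx .bot e
  | var (x : ℕ) : Approx (.var x) (.var x)
  | con (c : S.Con) (a b : Fin (S.conArity c) → Expr S) (h : ∀ i, Approx (a i) (b i)) :
      Approx (.con c a) (.con c b)
  | op (f : S.Op) (a b : Fin (S.opTy f).arity → Expr S) (h : ∀ i, Approx (a i) (b i)) :
      Approx (.op f a) (.op f b)

theorem Approx.refl (e : Expr S) : Approx e e := by
  induction e with
  | var x => exact .var x
  | bot => exact .bot _
  | con c args ih => exact .con c _ _ ih
  | op f args ih => exact .op f _ _ ih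

theorem Approx.eq_of_isValue {t e : Expr S} (h : Approx t e) (ht : t.IsValue) : t = e := by
  induction h with
  | bot => exact ht.elim
  | var => rfl
  | con c a b h ih => rw [funext fun i => ih i (ht i)]
  | op => exact ht.elim

/-- The constructors of `p` also stand in `e` and cannot be rewritten, so a step of `e` takes place
where `p` has `⊥`. -/
theorem Approx.of_funStep {P : Program S} {p e e' : Expr S} (h : Approx p e)
    (hp : p.IsPartialValue) (hs : FunStep P e e') : Approx p e' := by
  induction h generalizing e' with
  | bot => exact .bot _
  | var => exact hp.elim
  | con c a b h ih =>
    cases hs with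
    | here h' => cases h'
    | con _ _ i h' =>
      refine .con c _ _ fun j => ?_
      by_cases hj : j = i
      · subst hj
        simpa using ih j (hp j) h'
      · simpa [hj] using h j
  | op => exact hp.elim

theorem Approx.of_reflTransGen {P : Program S} {p e e' : Expr S} (h : Approx p e)
    (hp : p.IsPartialValue) (hs : ReflTransGen (FunStep P) e e') : Approx p e' := by
  induction hs with
  | refl => exact h
  | tail _ hs ih => exact ih.of_funStep hp hs

theorem Approx.subst (e : Expr S) {σ σ' : ℕ → Expr S}
    (h : ∀ x, e.occ x ≠ 0 → Approx (σ x) (σ' x)) : Approx (e.subst σ) (e.subst σ') := by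
  induction e with
  | var x => exact h x (by simp [Expr.occ])
  | bot => exact .bot _
  | con c args ih =>
    refine .con c _ _ fun i => ih i fun x hx => h x ?_
    simp only [Expr.occ, ne_eq, Finset.sum_eq_zero_iff, not_forall]
    exact ⟨i, Finset.mem_univ i, hx⟩
  | op f args ih =>
    refine .op f _ _ fun i => ih i fun x hx => h x ?_
    simp only [Expr.occ, ne_eq, Finset.sum_eq_zero_iff, not_forall]
    exact ⟨i, Finset.mem_univ i, hx⟩

theorem Expr.subst_congr (e : Expr S) {σ σ' : ℕ → Expr S}
    (h : ∀ x, e.occ x ≠ 0 → σ x = σ' x) : e.subst σ = e.subst σ' := by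
  induction e with
  | var x => exact h x (by simp [Expr.occ])
  | bot => rfl
  | con c args ih =>
    refine congrArg (Expr.con c) (funext fun i => ih i fun x hx => h x ?_)
    simp only [Expr.occ, ne_eq, Finset.sum_eq_zero_iff, not_forall]
    exact ⟨i, Finset.mem_univ i, hx⟩
  | op f args ih =>
    refine congrArg (Expr.op f) (funext fun i => ih i fun x hx => h x ?_)
    simp only [Expr.occ, ne_eq, Finset.sum_eq_zero_iff, not_forall]
    exact ⟨i, Finset.mem_univ i, hx⟩

/-- The matchers of a linear family of expressions combine to a single one. -/
theorem exists_common_matcher {n : ℕ} {ts ws : Fin n → Expr S} {σ : ℕ → Expr S}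
    (lin : ∀ x, ∑ i, (ts i).occ x ≤ 1)
    (h : ∀ i, ∃ σ' : ℕ → Expr S, (∀ x, (σ' x).IsPartialValue) ∧ (ts i).subst σ' = ws i ∧
      ∀ x, (ts i).occ x ≠ 0 → Approx (σ x) (σ' x)) :
    ∃ σ' : ℕ → Expr S, (∀ x, (σ' x).IsPartialValue) ∧ (∀ i, (ts i).subst σ' = ws i) ∧
      ∀ i x, (ts i).occ x ≠ 0 → Approx (σ x) (σ' x) := by
  classical
  choose s hs hw ha using h
  -- By linearity at most one member contains `x`, and its matcher is used there; `⊥` is a harmless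
  -- default for variables that occur nowhere.
  let σ' : ℕ → Expr S := fun x =>
    if hx : ∃ i, (ts i).occ x ≠ 0 then s hx.choose x else .bot
  have eq : ∀ i x, (ts i).occ x ≠ 0 → σ' x = s i x := by
    intro i x hi
    have hx : ∃ i, (ts i).occ x ≠ 0 := ⟨i, hi⟩
    have hci : hx.choose = i := by
      by_contra hne
      have hle := Finset.sum_le_sum_of_subset (f := fun i => (ts i).occ x)
        (Finset.subset_univ {hx.choose, i})
      rw [Finset.sum_pair hne] at hle
      have := hx.choose_spec
      have := lin x
      omega
    simp only [σ', dif_pos hx, hci]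
  refine ⟨σ', fun x => ?_, fun i => ?_, fun i x hi => ?_⟩
  · by_cases hx : ∃ i, (ts i).occ x ≠ 0
    · simp only [σ', dif_pos hx]
      exact hs _ x
    · simp only [σ', dif_neg hx]
      trivial
  · rw [← hw i]
    exact (ts i).subst_congr (eq i)
  · rw [eq i x hi]
    exact ha i x hi

/-- A value above an instance of a linear pattern is an instance of this pattern. -/
theorem Expr.IsPattern.exists_matcher {t : Expr S} (ht : t.IsPattern) (lin : ∀ x, t.occ x ≤ 1)
    {σ : ℕ → Expr S} {v : Expr S} (hv : v.IsValue) (h : Approx (t.subst σ) v) :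
    ∃ σ' : ℕ → Expr S, (∀ x, (σ' x).IsPartialValue) ∧ t.subst σ' = v ∧
      ∀ x, t.occ x ≠ 0 → Approx (σ x) (σ' x) := by
  induction t generalizing v with
  | var y =>
    refine ⟨fun _ => v, fun _ => hv.isPartialValue, rfl, fun x hx => ?_⟩
    have hyx : y = x := by
      by_contra hne
      simp [Expr.occ, hne] at hx
    exact hyx ▸ h
  | bot => exact ht.elim
  | con c args ih =>
    cases h with
    | con _ _ b h =>
      obtain ⟨σ', hp, hm, ha⟩ := exists_common_matcher (σ := σ) (ws := b) lin fun i =>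
        ih i (ht i) (fun x => le_trans
          (Finset.single_le_sum (f := fun i => (args i).occ x) (fun _ _ => Nat.zero_le _)
            (Finset.mem_univ i)) (lin x)) (hv i) (h i)
      refine ⟨σ', hp, congrArg (Expr.con c) (funext hm), fun x hx => ?_⟩
      simp only [Expr.occ, ne_eq, Finset.sum_eq_zero_iff, not_forall] at hx
      obtain ⟨i, -, hi⟩ := hx
      exact ha i x hi
  | op => exact ht.elim

/-- The non-strict reduction of an approximation is simulated by the strict reduction. -/
theorem Approx.exists_of_funBotStep {P : Program S} (total : ∀ f : S.Op, TotallyDefined P f)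
    {p p' e : Expr S} (hs : FunBotStep P p p') (h : Approx p e) {τ : S.Ty} (he : e.OfType τ) :
    ∃ e', ReflTransGen (FunStep P) e e' ∧ Approx p' e' := by
  induction hs generalizing e τ with
  | here hs =>
    rcases hs with hs | ⟨-, rfl⟩
    · cases hs with
      | mk r hr σ hσ =>
        cases h with
        | op _ _ b h =>
          obtain ⟨θ, rfl, hb⟩ := HasType.op_inv he
          -- Where `σ` supplies `⊥`, `b i` may still contain operations and so fail to be a legal
          -- instance. Evaluating the arguments first removes them, and the pattern instances still
          -- approximate the values.
          choose v hv hbv using fun i => exists_value total (hb i)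
          have wf := P.wf r hr
          obtain ⟨σ', hp, hm, ha⟩ := exists_common_matcher (σ := σ) (ws := v) wf.linear
            fun i => (wf.pattern i).exists_matcher (fun x => le_trans
              (Finset.single_le_sum (f := fun i => (r.lhs i).occ x)
                (fun _ _ => Nat.zero_le _) (Finset.mem_univ i)) (wf.linear x)) (hv i)
              ((h i).of_reflTransGen ((wf.pattern i).subst_isPartialValue hσ) (hbv i))
          refine ⟨r.rhs.subst σ', (reflTransGen_op r.op hbv).tail (.here ?_),
            Approx.subst _ fun x hx => ?_⟩
          · rw [← funext hm]
            exact .mk r hr σ' hp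
          · obtain ⟨i, hi⟩ := wf.noExtra x hx
            exact ha i x hi
    -- A (Bot) step needs no simulating step.
    · exact ⟨e, .refl, .bot e⟩
  | con c args i hs ih =>
    cases h with
    | con _ _ b h =>
      obtain ⟨θ, rfl, hb⟩ := HasType.con_inv he
      obtain ⟨d, hd, had⟩ := ih (h i) (hb i)
      refine ⟨.con c (Function.update b i d), reflTransGen_con c fun j => ?_,
        .con c _ _ fun j => ?_⟩ <;> by_cases hj : j = i
      · subst hj
        simpa using hd
      · simpa [hj] using ReflTransGen.refl
      · subst hj
        simpa using had
      · simpa [hj] using h j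
  | op f args i hs ih =>
    cases h with
    | op _ _ b h =>
      obtain ⟨θ, rfl, hb⟩ := HasType.op_inv he
      obtain ⟨d, hd, had⟩ := ih (h i) (hb i)
      refine ⟨.op f (Function.update b i d), reflTransGen_op f fun j => ?_,
        .op f _ _ fun j => ?_⟩ <;> by_cases hj : j = i
      · subst hj
        simpa using hd
      · simpa [hj] using ReflTransGen.refl
      · subst hj
        simpa using had
      · simpa [hj] using h j

theorem FunStep.funBotStep {P : Program S} {e e' : Expr S} (h : FunStep P e e') :
    FunBotStep P e e' := by
  induction h with
  | here h => exact .here (.inl h)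
  | con c args i h ih => exact .con c args i ih
  | op f args i h ih => exact .op f args i ih

/-- The strict and the non-strict reduction of a typable expression reach the same values. -/
theorem reflTransGen_funBotStep_iff {P : Program S} (total : ∀ f : S.Op, TotallyDefined P f)
    {e t : Expr S} {τ : S.Ty} (he : e.OfType τ) (ht : t.IsValue) :
    ReflTransGen (FunBotStep P) e t ↔ ReflTransGen (FunStep P) e t := by
  refine ⟨fun h => ?_, fun h =>
    ReflTransGen.mono (r := FunStep P) (fun _ _ h => FunStep.funBotStep h) _ _ h⟩
  have key : ∀ {p}, ReflTransGen (FunBotStep P) e p →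
      ∃ e', ReflTransGen (FunStep P) e e' ∧ Approx p e' := by
    intro p h
    induction h with
    | refl => exact ⟨e, .refl, .refl e⟩
    | tail _ hs ih =>
      obtain ⟨a, ha, hpa⟩ := ih
      obtain ⟨b, hb, hpb⟩ := hpa.exists_of_funBotStep total hs
        (ofType_of_reflTransGen_funStep ha he)
      exact ⟨b, ha.trans hb, hpb⟩
  obtain ⟨e', h', ha⟩ := key h
  rwa [ha.eq_of_isValue ht]

end FLP

theorem mainTheorem5 {S : FLP.Signature} (P : FLP.Program S)
    (total : ∀ f : S.Op, FLP.TotallyDefined P f)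
    (deterministic : ∀ f : S.Op, FLP.DeterministicallyDefined P f)
    (τ : FLP.OpTy S.tyArity) (f₁ f₂ : S.Op) (h₁ : S.opTy f₁ = τ) (h₂ : S.opTy f₂ = τ)
    (ground : FLP.GroundEquivalent P f₁ f₂ h₁ h₂) :
    FLP.Equivalent (FLP.FunStep P) f₁ f₂ h₁ h₂ ∧
      FLP.Equivalent (FLP.FunBotStep P) f₁ f₂ h₁ h₂ := by
  have strict := ground.equivalent_funStep total deterministic
  refine ⟨strict, fun e ρ he t ht => ?_⟩
  rw [FLP.reflTransGen_funBotStep_iff total he ht,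
    FLP.reflTransGen_funBotStep_iff total (FLP.HasType.replace he) ht]
  exact strict e ρ he t ht
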